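/- Let $\mathbb D$ be the open unit disk in $\mathbb C$, let $dA$ be the area measure on $\mathbb D$ normalized so that $A(\mathbb D)=1$, and for $\gamma>-1$ put $dA_\gamma(z)=(\gamma+1)(1-|z|^2)^\gamma\,dA(z)$. For $z,w\in\mathbb D$ let $$\rho(z,w)=\left|\frac{z-w}{1-\overline z w}\right|,\qquad \beta(z,w)=\frac12\log\frac{1+\rho(z,w)}{1-\rho(z,w)}$$ be the pseudo-hyperbolic and the hyperbolic metric. For $p>0$ and $\alpha>-1$ let $A^p_\alpha$ be the space of analytic functions $f$ in $\mathbb D$ with $\int_{\mathbb D}|f(z)|^p\,dA_\alpha(z)<\infty$. **Theorem 1.** Suppose $p>0$, $\alpha>-1$, and $f$ is analytic in $\mathbb D$. Then the following conditions are equivalent. (a) $f\in A^p_\alpha$. (b) There exists a continuous function $g:\mathbb D\to\mathbb R$ in $L^p(\mathbb D,dA_\alpha)$ such that $|f(z)-f(w)|\le\rho(z,w)\,(g(z)+g(w))$ for all $z,w\in\mathbb D$. (c) There exists a continuous function $g:\mathbb D\to\mathbb R$ in $L^p(\mathbb D,dA_\alpha)$ such that $|f(z)-f(w)|\le\beta(z,w)\,(g(z)+g(w))$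 for all $z,w\in\mathbb D$. (d) There exists a continuous function $g:\mathbb D\to\mathbb R$ in $L^p(\mathbb D,dA_{p+\alpha})$ such that $|f(z)-f(w)|\le|z-w|\,(g(z)+g(w))$ for all $z,w\in\mathbb D$. -/

import Mathlib

open MeasureTheory
open scoped ENNReal

noncomputable section

/-- The open unit disk in the complex plane. -/
def unitDisk : Set ℂ := Metric.ball 0 1

/-- Normalized area measure on the unit disk, viewed as a measure on `ℂ` carried by the disk. -/
def diskArea : Measure ℂ := (ENNReal.ofReal Real.pi)⁻¹ • volume.restrict unitDisk

/-- The weighted area measure `(α + 1) (1 - |z|²) ^ α dA(z)` on the unit disk. -/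
def weightedArea (α : ℝ) : Measure ℂ :=
  diskArea.withDensity fun z => ENNReal.ofReal ((α + 1) * (1 - ‖z‖ ^ 2) ^ α)

/-- Membership in the weighted Bergman space: `f` is analytic in the unit disk and
`|f| ^ p` has finite integral with respect to the weighted area measure.
Values of `f` outside the disk play no role. -/
def MemBergman (p α : ℝ) (f : ℂ → ℂ) : Prop :=
  AnalyticOnNhd ℂ f unitDisk ∧ ∫⁻ z, ENNReal.ofReal (‖f z‖ ^ p) ∂(weightedArea α) < ∞

/-- The pseudo-hyperbolic metric `ρ` on the unit disk. -/
def pseudoHyperbolicDist (z w : ℂ) : ℝ := ‖(z - w) / (1 - (starRingEnd ℂ) z * w)‖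

/-- The hyperbolic (Bergman, Poincaré) metric `β` on the unit disk. -/
def hyperbolicDist (z w : ℂ) : ℝ :=
  1 / 2 * Real.log ((1 + pseudoHyperbolicDist z w) / (1 - pseudoHyperbolicDist z w))

/-- There is a continuous real function `g` on the disk, belonging to `L^p(μ)`, such that
`|f z - f w| ≤ d(z, w) (g z + g w)` for all `z, w` in the disk. The measure `μ` is meant to be
carried by the disk, so that values of `g` outside the disk play no role. -/
def HasLipschitzMajorant (p : ℝ) (μ : Measure ℂ) (d : ℂ → ℂ → ℝ) (f : ℂ → ℂ) : Prop :=
  ∃ g : ℂ → ℝ, ContinuousOn g unitDisk ∧ MemLp g (ENNReal.ofReal p) μ ∧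
    ∀ z ∈ unitDisk, ∀ w ∈ unitDisk, ‖f z - f w‖ ≤ d z w * (g z + g w)

end

open MeasureTheory Metric
open scoped ENNReal

/-! For f in the Bergman space, the majorant is a multiple of the supremum of |f| over a disk around
z of radius comparable to 1 - |z|. The Schwarz lemma bounds the oscillation of f by this supremum
(`norm_sub_le_pseudoHyperbolicDist_mul_localSup`). A local mean-value bound for |f|^p
(`exists_norm_rpow_mul_sq_le_lintegral`) and Tonelli's theorem place it in L^p
(`lintegral_localSup_lt_top`). The hyperbolic condition follows from ρ ≤ β, and the Euclidean one by
dividing the majorant by 1 - |z|².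

The way back uses no derivative of f. Near the circle, z is compared with its radial pull φ(z), at
distance K(1 - |z|) from the circle. The hyperbolic distance from z to φ(z) is bounded in terms of
K, so |f(z)| ≤ |f(φ(z))| + C_K (|g(z)| + |g(φ(z))|). Composition with φ multiplies weighted
integrals by at most a constant times K^(-(1+α)) (`lintegral_comp_radialPull_le`). As α > -1, a
large K lets the f(φ(z)) term be absorbed into the left side
(`lintegral_lt_top_of_le_comp_radialPull`). -/

/-! ### Weighted integrals on the disk. -/

/-- The unnormalized weight `(1 - |z|²) ^ α` on the disk, as an extended nonnegative real. -/
noncomputable def diskWeight (α : ℝ) (z : ℂ) : ℝ≥0∞ := ENNReal.ofReal ((1 - ‖z‖ ^ 2) ^ α)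

theorem mem_unitDisk {z : ℂ} : z ∈ unitDisk ↔ ‖z‖ < 1 := by simp [unitDisk]

theorem measurableSet_unitDisk : MeasurableSet unitDisk := measurableSet_ball

theorem one_sub_norm_sq_pos {z : ℂ} (hz : z ∈ unitDisk) : 0 < 1 - ‖z‖ ^ 2 := by
  rw [mem_unitDisk] at hz
  nlinarith [norm_nonneg z]

theorem measurable_diskWeight (α : ℝ) : Measurable (diskWeight α) := by
  unfold diskWeight
  fun_prop

theorem diskWeight_ne_top (α : ℝ) (z : ℂ) : diskWeight α z ≠ ∞ := ENNReal.ofReal_ne_top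

/-- Only finiteness matters, so the positive constants α + 1 and 1/π can be dropped. -/
theorem lintegral_weightedArea_lt_top_iff {α : ℝ} (hα : -1 < α) (F : ℂ → ℝ≥0∞) :
    ∫⁻ z, F z ∂(weightedArea α) < ∞ ↔ ∫⁻ z in unitDisk, diskWeight α z * F z < ∞ := by
  have hpi : (ENNReal.ofReal Real.pi) ≠ 0 := by simp [Real.pi_pos]
  unfold weightedArea diskArea
  rw [lintegral_withDensity_eq_lintegral_mul_non_measurable _ (by fun_prop)
    (by simp), lintegral_smul_measure]
  have h : ∀ z : ℂ, ((fun z : ℂ => ENNReal.ofReal ((α + 1) * (1 - ‖z‖ ^ 2) ^ α)) * F) z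
      = ENNReal.ofReal (α + 1) * (diskWeight α z * F z) := by
    intro z
    simp only [Pi.mul_apply, diskWeight]
    rw [ENNReal.ofReal_mul (by linarith), mul_assoc]
  simp_rw [h]
  rw [lintegral_const_mul' _ _ ENNReal.ofReal_ne_top, smul_eq_mul]
  have h1 : ENNReal.ofReal (α + 1) ≠ 0 := by simp; linarith
  constructor
  · intro H
    by_contra hc
    rw [not_lt, top_le_iff] at hc
    rw [hc, ENNReal.mul_top h1, ENNReal.mul_top (by simp)] at H
    exact lt_irrefl _ H
  · intro H
    exact ENNReal.mul_lt_top (by simp [Real.pi_pos]) (ENNReal.mul_lt_top (by simp) H)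

theorem weightedArea_absolutelyContinuous (α : ℝ) :
    weightedArea α ≪ volume.restrict unitDisk :=
  (withDensity_absolutelyContinuous _ _).trans Measure.smul_absolutelyContinuous

theorem memLp_weightedArea_iff {p α : ℝ} (hp : 0 < p) (hα : -1 < α) {g : ℂ → ℝ}
    (hg : ContinuousOn g unitDisk) :
    MemLp g (ENNReal.ofReal p) (weightedArea α) ↔
      ∫⁻ z in unitDisk, diskWeight α z * ENNReal.ofReal (|g z| ^ p) < ∞ := by
  rw [← lintegral_weightedArea_lt_top_iff hα]
  have hm : AEStronglyMeasurable g (weightedArea α) :=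
    (hg.aestronglyMeasurable measurableSet_unitDisk).mono_ac (weightedArea_absolutelyContinuous α)
  have he : ∀ z, ENNReal.ofReal (|g z| ^ p) = ‖g z‖ₑ ^ p := fun z => by
    rw [← ENNReal.ofReal_rpow_of_nonneg (abs_nonneg _) hp.le, Real.enorm_eq_ofReal_abs]
  simp_rw [he]
  rw [MemLp, eLpNorm_lt_top_iff_lintegral_rpow_enorm_lt_top (by simpa using hp) (by simp),
    ENNReal.toReal_ofReal hp.le]
  exact and_iff_right hm

/-! ### Local mean-value inequality. -/

/-- Local `L^p` bound for holomorphic functions, for every exponent `p > 0`. -/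
theorem exists_norm_rpow_mul_sq_le_lintegral {p : ℝ} (hp : 0 < p) :
    ∃ C : ℝ, 0 ≤ C ∧ ∀ (f : ℂ → ℂ) (c : ℂ) (R : ℝ), 0 < R → DifferentiableOn ℂ f (ball c R) →
      ContinuousOn f (closedBall c R) → ∀ z ∈ closedBall c (R / 2),
      ENNReal.ofReal (‖f z‖ ^ p * R ^ 2) ≤
        ENNReal.ofReal C * ∫⁻ u in ball c R, ENNReal.ofReal (‖f u‖ ^ p) := by
  -- L^p = 4 is the square of the factor 2 by which the distance to the boundary circle can shrink
  -- between w and a point of `ball w (d / 2)`.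
  set L : ℝ := 4 ^ (1 / p) with hL
  have hL0 : 0 < L := by positivity
  have hLp : L ^ p = 4 := by
    rw [hL, ← Real.rpow_mul (by norm_num), one_div_mul_cancel hp.ne', Real.rpow_one]
  -- Chosen so that the Schwarz lemma on `ball w (d / 2)`, with image radius (L + 1)|f(w)|, moves f
  -- by at most |f(w)|/2 on `ball w (ε * d)`.
  set ε : ℝ := 1 / (4 * (L + 1)) with hε
  have hε0 : 0 < ε := by positivity
  have hε1 : ε ≤ 1 / 4 := by
    rw [hε]; apply one_div_le_one_div_of_le <;> linarith
  -- The 4 comes from z lying in the half-radius disk, 2^p from |f| ≥ |f(w)|/2, and ε²π from the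
  -- area of `ball w (ε * d)`.
  refine ⟨4 * 2 ^ p / (ε ^ 2 * Real.pi), by positivity, ?_⟩
  intro f c R hR hd hc z hz
  -- Maximizing |f|^p times the squared distance to the boundary replaces subharmonicity: near the
  -- maximizer w, |f| is at most L|f(w)|, hence also bounded below by Schwarz.
  have hcont : ContinuousOn (fun z => ‖f z‖ ^ p * (R - ‖z - c‖) ^ 2) (closedBall c R) := by
    refine ContinuousOn.mul ?_ (by fun_prop)
    exact hc.norm.rpow_const fun _ _ => Or.inr hp.le
  obtain ⟨w, hw, hmax⟩ := (isCompact_closedBall c R).exists_isMaxOn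
    ⟨c, mem_closedBall_self hR.le⟩ hcont
  have hmax' : ∀ u, ‖u - c‖ ≤ R →
      ‖f u‖ ^ p * (R - ‖u - c‖) ^ 2 ≤ ‖f w‖ ^ p * (R - ‖w - c‖) ^ 2 := fun u hu =>
    hmax (by simpa [dist_eq_norm] using hu)
  rw [mem_closedBall, dist_eq_norm] at hz hw
  set d := R - ‖w - c‖ with hdd
  have hzle : ‖f z‖ ^ p * R ^ 2 ≤ 4 * (‖f w‖ ^ p * d ^ 2) := by
    have h1 := hmax' z (by linarith)
    have h2 : (R / 2) ^ 2 ≤ (R - ‖z - c‖) ^ 2 := by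
      apply pow_le_pow_left₀ <;> linarith
    have h3 : ‖f z‖ ^ p * (R / 2) ^ 2 ≤ ‖f z‖ ^ p * (R - ‖z - c‖) ^ 2 := by gcongr
    nlinarith
  have hd0 : 0 ≤ d := by linarith
  rcases hd0.eq_or_lt with h0 | hdpos
  · rw [← h0] at hzle
    rw [ENNReal.ofReal_of_nonpos (by simpa using hzle)]
    exact zero_le
  have hbig : ∀ u ∈ ball w (d / 2), ‖f u‖ ≤ L * ‖f w‖ := by
    intro u hu
    rw [mem_ball, dist_eq_norm] at hu
    have htri : ‖u - c‖ ≤ ‖u - w‖ + ‖w - c‖ := by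
      simpa using norm_add_le (u - w) (w - c)
    have h1 := hmax' u (by linarith)
    have h2 : (d / 2) ^ 2 ≤ (R - ‖u - c‖) ^ 2 := by
      apply pow_le_pow_left₀ <;> linarith
    have h3 : ‖f u‖ ^ p * (d / 2) ^ 2 ≤ ‖f u‖ ^ p * (R - ‖u - c‖) ^ 2 := by gcongr
    have h4 : ‖f u‖ ^ p ≤ (L * ‖f w‖) ^ p := by
      rw [Real.mul_rpow hL0.le (norm_nonneg _), hLp]
      have : 0 < d ^ 2 := by positivity
      nlinarith
    exact (Real.rpow_le_rpow_iff (norm_nonneg _) (by positivity) hp).1 h4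
  have hsub : ball w (d / 2) ⊆ ball c R := by
    apply ball_subset_ball'
    rw [dist_eq_norm]; linarith
  have hlow : ∀ u ∈ ball w (ε * d), ‖f w‖ / 2 ≤ ‖f u‖ := by
    intro u hu
    have hu2 : u ∈ ball w (d / 2) := ball_subset_ball (by nlinarith) hu
    have hmaps : Set.MapsTo f (ball w (d / 2)) (closedBall (f w) ((L + 1) * ‖f w‖)) := by
      intro v hv
      rw [mem_closedBall, dist_eq_norm]
      calc ‖f v - f w‖ ≤ ‖f v‖ + ‖f w‖ := norm_sub_le _ _
        _ ≤ (L + 1) * ‖f w‖ := by linarith [hbig v hv]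
    have h := Complex.dist_le_div_mul_dist_of_mapsTo_ball (hd.mono hsub) hmaps hu2
    rw [mem_ball] at hu
    have h5 : (L + 1) * ‖f w‖ / (d / 2) * dist u w ≤ (L + 1) * ‖f w‖ / (d / 2) * (ε * d) := by
      gcongr
    have h6 : (L + 1) * ‖f w‖ / (d / 2) * (ε * d) = ‖f w‖ / 2 := by
      rw [hε]; field_simp; norm_num
    have h7 : ‖f w‖ ≤ ‖f u‖ + ‖f u - f w‖ := by
      simpa using norm_sub_le (f u) (f u - f w)
    rw [dist_eq_norm] at h
    linarith
  have hint : ENNReal.ofReal ((‖f w‖ / 2) ^ p) * volume (ball w (ε * d)) ≤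
      ∫⁻ u in ball c R, ENNReal.ofReal (‖f u‖ ^ p) := by
    rw [← setLIntegral_const]
    refine (setLIntegral_mono' measurableSet_ball fun u hu => ?_).trans
      (lintegral_mono_set ((ball_subset_ball (by nlinarith)).trans hsub))
    exact ENNReal.ofReal_le_ofReal (Real.rpow_le_rpow (by positivity) (hlow u hu) hp.le)
  refine le_trans ?_ (mul_le_mul_right hint _)
  have hvol : volume (ball w (ε * d)) = ENNReal.ofReal ((ε * d) ^ 2 * Real.pi) := by
    rw [Complex.volume_ball, ← ENNReal.ofReal_pow (by positivity),
      ENNReal.ofReal_mul (p := (ε * d) ^ 2) (by positivity)]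
    congr 1
    rw [← NNReal.coe_real_pi, ENNReal.ofReal_coe_nnreal]
  rw [hvol, ← ENNReal.ofReal_mul (by positivity), ← ENNReal.ofReal_mul (by positivity)]
  apply ENNReal.ofReal_le_ofReal
  refine hzle.trans_eq ?_
  rw [Real.div_rpow (norm_nonneg _) (by norm_num)]
  field_simp

/-! ### The local supremum of |f|. -/

/-- The supremum of `|f|` over the closed disk of radius `(1 - |z|) / 4` around `z`. -/
noncomputable def localSup (f : ℂ → ℂ) (z : ℂ) : ℝ :=
  sSup ((fun u : ℂ => ‖f (z + ((1 - ‖z‖) / 4 : ℝ) * u)‖) '' closedBall 0 1)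

theorem add_mul_mem_unitDisk {z u : ℂ} (hz : z ∈ unitDisk) (hu : u ∈ closedBall (0 : ℂ) 1) :
    z + ((1 - ‖z‖) / 4 : ℝ) * u ∈ unitDisk := by
  rw [mem_unitDisk] at *
  rw [mem_closedBall, dist_zero_right] at hu
  have h : ‖(((1 - ‖z‖) / 4 : ℝ) : ℂ) * u‖ ≤ (1 - ‖z‖) / 4 := by
    rw [norm_mul, Complex.norm_real, Real.norm_of_nonneg (by linarith)]
    nlinarith
  linarith [norm_add_le z ((((1 - ‖z‖) / 4 : ℝ) : ℂ) * u)]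

theorem continuousOn_localSup_integrand {f : ℂ → ℂ} (hf : ContinuousOn f unitDisk) {z : ℂ}
    (hz : z ∈ unitDisk) :
    ContinuousOn (fun u : ℂ => ‖f (z + ((1 - ‖z‖) / 4 : ℝ) * u)‖) (closedBall 0 1) :=
  (hf.comp (by fun_prop) fun _ hu => add_mul_mem_unitDisk hz hu).norm

theorem norm_le_localSup {f : ℂ → ℂ} (hf : ContinuousOn f unitDisk) {z w : ℂ}
    (hz : z ∈ unitDisk) (hw : ‖w - z‖ ≤ (1 - ‖z‖) / 4) : ‖f w‖ ≤ localSup f z := by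
  have ht : 0 < (1 - ‖z‖) / 4 := by rw [mem_unitDisk] at hz; linarith
  have ht' : (((1 - ‖z‖) / 4 : ℝ) : ℂ) ≠ 0 := by exact_mod_cast ht.ne'
  refine le_csSup ((isCompact_closedBall _ _).bddAbove_image
    (continuousOn_localSup_integrand hf hz)) ⟨(w - z) / ((1 - ‖z‖) / 4 : ℝ), ?_, ?_⟩
  · rw [mem_closedBall, dist_zero_right, norm_div, Complex.norm_real, Real.norm_of_nonneg ht.le]
    exact div_le_one_of_le₀ hw ht.le
  · simp only
    rw [mul_div_cancel₀ _ ht', add_sub_cancel]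

theorem exists_localSup_eq {f : ℂ → ℂ} (hf : ContinuousOn f unitDisk) {z : ℂ}
    (hz : z ∈ unitDisk) : ∃ w, ‖w - z‖ ≤ (1 - ‖z‖) / 4 ∧ localSup f z = ‖f w‖ := by
  obtain ⟨u, hu, h⟩ := (isCompact_closedBall (0 : ℂ) 1).exists_sSup_image_eq
    ⟨0, mem_closedBall_self zero_le_one⟩ (continuousOn_localSup_integrand hf hz)
  refine ⟨_, ?_, h⟩
  rw [mem_unitDisk] at hz
  rw [mem_closedBall, dist_zero_right] at hu
  rw [add_sub_cancel_left, norm_mul, Complex.norm_real, Real.norm_of_nonneg (by linarith)]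
  nlinarith

theorem localSup_nonneg {f : ℂ → ℂ} (hf : ContinuousOn f unitDisk) {z : ℂ}
    (hz : z ∈ unitDisk) : 0 ≤ localSup f z := by
  obtain ⟨w, -, h⟩ := exists_localSup_eq hf hz
  rw [h]; exact norm_nonneg _

/-- After rescaling, the supremum of a jointly continuous function runs over one fixed compact ball,
and so depends continuously on z. -/
theorem continuousOn_localSup {f : ℂ → ℂ} (hf : ContinuousOn f unitDisk) :
    ContinuousOn (localSup f) unitDisk := by
  rw [continuousOn_iff_continuous_domRestrict]
  have : CompactSpace (closedBall (0 : ℂ) 1) :=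
    isCompact_iff_compactSpace.1 (isCompact_closedBall _ _)
  let F : unitDisk → closedBall (0 : ℂ) 1 → ℝ := fun z u =>
    ‖f ((z : ℂ) + ((1 - ‖(z : ℂ)‖) / 4 : ℝ) * u)‖
  have hF : Continuous (fun q : unitDisk × closedBall (0 : ℂ) 1 => F q.1 q.2) := by
    refine (hf.comp_continuous (by fun_prop) fun q => ?_).norm
    exact add_mul_mem_unitDisk q.1.2 q.2.2
  convert isCompact_univ.continuous_sSup (f := F) hF using 2 with z
  simp only [Set.domRestrict_apply, localSup]
  congr 1
  ext y
  simp [F]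

/-! ### The pseudo-hyperbolic Lipschitz estimate. -/

theorem norm_one_sub_conj_mul_le (z w : ℂ) :
    ‖1 - (starRingEnd ℂ) z * w‖ ≤ |1 - ‖z‖ ^ 2| + ‖z‖ * ‖z - w‖ := by
  have h : 1 - (starRingEnd ℂ) z * w
      = ((1 - ‖z‖ ^ 2 : ℝ) : ℂ) + (starRingEnd ℂ) z * (z - w) := by
    have := Complex.conj_mul' z
    push_cast
    linear_combination -this
  rw [h]
  refine (norm_add_le _ _).trans_eq ?_
  rw [Complex.norm_real, norm_mul, RCLike.norm_conj, Real.norm_eq_abs]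

theorem one_sub_norm_le_norm_one_sub_conj_mul {z w : ℂ} (hw : w ∈ unitDisk) :
    1 - ‖z‖ ≤ ‖1 - (starRingEnd ℂ) z * w‖ := by
  rw [mem_unitDisk] at hw
  have h := norm_sub_norm_le 1 ((starRingEnd ℂ) z * w)
  rw [norm_mul, RCLike.norm_conj, norm_one] at h
  nlinarith [norm_nonneg z, norm_nonneg w]

theorem norm_one_sub_conj_mul_pos {z w : ℂ} (hz : z ∈ unitDisk) (hw : w ∈ unitDisk) :
    0 < ‖1 - (starRingEnd ℂ) z * w‖ :=
  lt_of_lt_of_le (by rw [mem_unitDisk] at hz; linarith) (one_sub_norm_le_norm_one_sub_conj_mul hw)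

theorem pseudoHyperbolicDist_mul_norm {z w : ℂ} (hz : z ∈ unitDisk) (hw : w ∈ unitDisk) :
    pseudoHyperbolicDist z w * ‖1 - (starRingEnd ℂ) z * w‖ = ‖z - w‖ := by
  rw [pseudoHyperbolicDist, norm_div, div_mul_cancel₀ _ (norm_one_sub_conj_mul_pos hz hw).ne']

/-- Put t = (1 - |z|)/4. If |z - w| < t, then |1 - z̄w| ≤ 9t, and Schwarz with image radius twice
the local supremum gives 18 = 2 · 9. Otherwise ρ ≥ 1/9 and the triangle inequality suffices. -/
theorem norm_sub_le_pseudoHyperbolicDist_mul_localSup {f : ℂ → ℂ}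
    (hf : AnalyticOnNhd ℂ f unitDisk) {z w : ℂ} (hz : z ∈ unitDisk) (hw : w ∈ unitDisk) :
    ‖f z - f w‖ ≤ pseudoHyperbolicDist z w * (18 * localSup f z + 18 * localSup f w) := by
  have hc := hf.continuousOn
  have hz' := mem_unitDisk.1 hz
  have hw' := mem_unitDisk.1 hw
  have hM := localSup_nonneg hc hz
  have hN := localSup_nonneg hc hw
  have hfz : ‖f z‖ ≤ localSup f z := norm_le_localSup hc hz (by simp; linarith)
  have hfw : ‖f w‖ ≤ localSup f w := norm_le_localSup hc hw (by simp; linarith)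
  have hρ := pseudoHyperbolicDist_mul_norm hz hw
  have hρ0 : 0 ≤ pseudoHyperbolicDist z w := norm_nonneg _
  set ρ := pseudoHyperbolicDist z w
  have hden : ‖1 - (starRingEnd ℂ) z * w‖ ≤ 8 * ((1 - ‖z‖) / 4) + ‖z - w‖ := by
    refine (norm_one_sub_conj_mul_le z w).trans ?_
    rw [abs_of_pos (one_sub_norm_sq_pos hz)]
    nlinarith [norm_nonneg z, norm_nonneg (z - w)]
  set D := ‖1 - (starRingEnd ℂ) z * w‖
  have hρN : 0 ≤ ρ * localSup f w := by positivity
  rcases lt_or_ge ‖z - w‖ ((1 - ‖z‖) / 4) with h | h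
  · have hmaps : Set.MapsTo f (ball z ((1 - ‖z‖) / 4)) (closedBall (f z) (2 * localSup f z)) := by
      intro v hv
      rw [mem_ball, dist_eq_norm] at hv
      rw [mem_closedBall, dist_eq_norm]
      linarith [norm_sub_le (f v) (f z), norm_le_localSup hc hz hv.le]
    have hsub : ball z ((1 - ‖z‖) / 4) ⊆ unitDisk := by
      apply ball_subset_ball'
      rw [dist_zero_right]; linarith
    have hS := Complex.dist_le_div_mul_dist_of_mapsTo_ball
      (hf.differentiableOn.mono hsub) hmaps (z := w)
      (by rwa [mem_ball, dist_eq_norm, norm_sub_rev])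
    rw [dist_eq_norm, dist_eq_norm, norm_sub_rev, norm_sub_rev w z] at hS
    have ht : 0 < (1 - ‖z‖) / 4 := by linarith
    have h1 : ‖z - w‖ ≤ ρ * (9 * ((1 - ‖z‖) / 4)) := by
      rw [← hρ]; gcongr; linarith
    have h2 : 2 * localSup f z / ((1 - ‖z‖) / 4) * ‖z - w‖ ≤
        2 * localSup f z / ((1 - ‖z‖) / 4) * (ρ * (9 * ((1 - ‖z‖) / 4))) := by gcongr
    have h3 : 2 * localSup f z / ((1 - ‖z‖) / 4) * (ρ * (9 * ((1 - ‖z‖) / 4))) =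
        18 * (ρ * localSup f z) := by
      have : 1 - ‖z‖ ≠ 0 := by linarith
      field_simp; ring
    linarith
  · have hpos : 0 < ‖z - w‖ := by linarith
    have h9 : 1 ≤ 9 * ρ := by
      by_contra! hlt
      have hD : D ≤ 9 * ‖z - w‖ := by linarith
      have : ρ * D ≤ ρ * (9 * ‖z - w‖) := by gcongr
      nlinarith
    have := norm_sub_le (f z) (f w)
    nlinarith

/-! ### The local supremum is in L^p. -/

theorem rpow_le_four_rpow_abs_mul {a b : ℝ} (ha : 0 < a) (hb : 0 < b) (hab : a ≤ 4 * b)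
    (hba : b ≤ 4 * a) (α : ℝ) : a ^ α ≤ 4 ^ |α| * b ^ α := by
  rcases le_total 0 α with h | h
  · rw [abs_of_nonneg h, ← Real.mul_rpow (by norm_num) hb.le]
    exact Real.rpow_le_rpow ha.le hab h
  · rw [abs_of_nonpos h, Real.rpow_neg (by norm_num), ← Real.inv_rpow (by norm_num),
      ← Real.mul_rpow (by norm_num) hb.le]
    exact Real.rpow_le_rpow_of_nonpos (by positivity) (by linarith) h

/-- The mean-value bound on the disk of radius R = (1 - |z|)/2 about z, with every factor moved from
z to u. That disk lies in |z - u| < 1 - |u|, a condition which for fixed u is a disk in z, ready for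
Tonelli. The 9 comes from 1 - |u| ≤ 3R. -/
theorem diskWeight_mul_localSup_le {p : ℝ} (hp : 0 < p) (α : ℝ) :
    ∃ C : ℝ≥0∞, C ≠ ∞ ∧ ∀ f : ℂ → ℂ, AnalyticOnNhd ℂ f unitDisk → ∀ z ∈ unitDisk,
      diskWeight α z * ENNReal.ofReal (localSup f z ^ p) ≤
        ∫⁻ u in unitDisk, {q : ℂ × ℂ | ‖q.1 - q.2‖ < 1 - ‖q.2‖}.indicator 1 (z, u) *
          (C * ENNReal.ofReal (((1 - ‖u‖) ^ 2)⁻¹) *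
            (diskWeight α u * ENNReal.ofReal (‖f u‖ ^ p))) := by
  obtain ⟨C, hC0, hC⟩ := exists_norm_rpow_mul_sq_le_lintegral hp
  refine ⟨ENNReal.ofReal (9 * 4 ^ |α| * C), ENNReal.ofReal_ne_top, fun f hf z hz => ?_⟩
  have hz' := mem_unitDisk.1 hz
  obtain ⟨w, hw, hMw⟩ := exists_localSup_eq hf.continuousOn hz
  set R := (1 - ‖z‖) / 2 with hR
  have hR0 : 0 < R := by linarith
  have hsub : closedBall z R ⊆ unitDisk := by
    apply closedBall_subset_ball'
    rw [dist_zero_right]; linarith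
  have hkey := hC f z R hR0 (hf.differentiableOn.mono (ball_subset_closedBall.trans hsub))
    (hf.continuousOn.mono hsub) w (by rw [mem_closedBall, dist_eq_norm]; linarith)
  rw [← hMw] at hkey
  have h1 : diskWeight α z * ENNReal.ofReal (localSup f z ^ p) ≤
      (diskWeight α z * ENNReal.ofReal ((R ^ 2)⁻¹) * ENNReal.ofReal C) *
        ∫⁻ u in ball z R, ENNReal.ofReal (‖f u‖ ^ p) := by
    rw [mul_assoc, mul_assoc]
    gcongr
    refine le_trans (le_of_eq ?_) (mul_le_mul_right hkey _)
    rw [← ENNReal.ofReal_mul (by positivity)]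
    congr 1
    field_simp
  refine h1.trans ?_
  rw [← lintegral_const_mul' _ _ (by
    exact ENNReal.mul_ne_top (ENNReal.mul_ne_top (diskWeight_ne_top _ _) ENNReal.ofReal_ne_top)
      ENNReal.ofReal_ne_top)]
  refine (setLIntegral_mono' measurableSet_ball fun u hu => ?_).trans
      (lintegral_mono_set (ball_subset_closedBall.trans hsub))
  have huD : u ∈ unitDisk := hsub (ball_subset_closedBall hu)
  have hu' := mem_unitDisk.1 huD
  rw [mem_ball, dist_eq_norm] at hu
  have hzu : ‖z‖ ≤ ‖u‖ + ‖u - z‖ := by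
    simpa using norm_sub_le u (u - z)
  have huz : ‖u‖ ≤ ‖z‖ + ‖u - z‖ := by
    simpa using norm_add_le z (u - z)
  rw [Set.indicator_of_mem (by
    simp only [Set.mem_ofPred_eq]; rw [norm_sub_rev]; linarith), Pi.one_apply, one_mul, ← mul_assoc]
  refine mul_le_mul_left ?_ _
  unfold diskWeight
  have hzp := one_sub_norm_sq_pos hz
  have hup := one_sub_norm_sq_pos huD
  have hu1 : 0 < 1 - ‖u‖ := by linarith
  rw [← ENNReal.ofReal_mul (by positivity), ← ENNReal.ofReal_mul (by positivity),
    ← ENNReal.ofReal_mul (by positivity), ← ENNReal.ofReal_mul (by positivity)]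
  apply ENNReal.ofReal_le_ofReal
  have ha : (1 - ‖z‖ ^ 2) ^ α ≤ 4 ^ |α| * (1 - ‖u‖ ^ 2) ^ α := by
    apply rpow_le_four_rpow_abs_mul hzp hup <;> nlinarith [norm_nonneg z, norm_nonneg u]
  have hb : (R ^ 2)⁻¹ ≤ 9 * ((1 - ‖u‖) ^ 2)⁻¹ := by
    rw [← div_eq_mul_inv, le_div_iff₀ (by positivity), inv_mul_le_iff₀ (by positivity)]
    nlinarith
  calc (1 - ‖z‖ ^ 2) ^ α * (R ^ 2)⁻¹ * C
      ≤ (4 ^ |α| * (1 - ‖u‖ ^ 2) ^ α) * (9 * ((1 - ‖u‖) ^ 2)⁻¹) * C := by gcongr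
    _ = _ := by ring

/-- After Tonelli, the z-integral is at most the area π(1 - |u|)², which cancels the factor (1 -
|u|)⁻². -/
theorem lintegral_localSup_lt_top {p : ℝ} (hp : 0 < p) (α : ℝ) {f : ℂ → ℂ}
    (hf : AnalyticOnNhd ℂ f unitDisk)
    (hint : ∫⁻ z in unitDisk, diskWeight α z * ENNReal.ofReal (‖f z‖ ^ p) < ∞) :
    ∫⁻ z in unitDisk, diskWeight α z * ENNReal.ofReal (localSup f z ^ p) < ∞ := by
  obtain ⟨C, hC, h⟩ := diskWeight_mul_localSup_le hp α
  refine (setLIntegral_mono' measurableSet_unitDisk fun z hz => h f hf z hz).trans_lt ?_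
  have hS : MeasurableSet {q : ℂ × ℂ | ‖q.1 - q.2‖ < 1 - ‖q.2‖} :=
    measurableSet_lt (by fun_prop) (by fun_prop)
  have hfm : AEMeasurable f (volume.restrict unitDisk) :=
    hf.continuousOn.aemeasurable measurableSet_unitDisk
  have hQ : AEMeasurable (fun u => C * ENNReal.ofReal (((1 - ‖u‖) ^ 2)⁻¹) *
      (diskWeight α u * ENNReal.ofReal (‖f u‖ ^ p))) (volume.restrict unitDisk) := by
    have := measurable_diskWeight α
    fun_prop
  rw [lintegral_lintegral_swap]
  · have hle : ∀ u ∈ unitDisk, ∫⁻ z in unitDisk,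
        {q : ℂ × ℂ | ‖q.1 - q.2‖ < 1 - ‖q.2‖}.indicator 1 (z, u) *
          (C * ENNReal.ofReal (((1 - ‖u‖) ^ 2)⁻¹) *
            (diskWeight α u * ENNReal.ofReal (‖f u‖ ^ p))) ≤
        (C * NNReal.pi) * (diskWeight α u * ENNReal.ofReal (‖f u‖ ^ p)) := by
      intro u hu
      have hu1 : 0 < 1 - ‖u‖ := by rw [mem_unitDisk] at hu; linarith
      have hfun : (fun z : ℂ => {q : ℂ × ℂ | ‖q.1 - q.2‖ < 1 - ‖q.2‖}.indicator
          (1 : ℂ × ℂ → ℝ≥0∞) (z, u)) = (ball u (1 - ‖u‖)).indicator 1 := by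
        ext z
        by_cases hz : ‖z - u‖ < 1 - ‖u‖ <;> simp [Set.indicator, dist_eq_norm, hz]
      rw [lintegral_mul_const'' _ (by
        rw [hfun]; exact (measurable_one.indicator measurableSet_ball).aemeasurable), hfun]
      have hv : ∫⁻ z in unitDisk, (ball u (1 - ‖u‖)).indicator 1 z ≤
          ENNReal.ofReal (1 - ‖u‖) ^ 2 * NNReal.pi := by
        refine (setLIntegral_le_lintegral _ _).trans_eq ?_
        rw [lintegral_indicator_one measurableSet_ball, Complex.volume_ball]
      refine (mul_le_mul_left hv _).trans_eq ?_
      have hone : ENNReal.ofReal (1 - ‖u‖) ^ 2 * ENNReal.ofReal (((1 - ‖u‖) ^ 2)⁻¹) = 1 := by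
        rw [← ENNReal.ofReal_pow hu1.le, ← ENNReal.ofReal_mul (by positivity),
          mul_inv_cancel₀ (by positivity), ENNReal.ofReal_one]
      calc _ = (ENNReal.ofReal (1 - ‖u‖) ^ 2 * ENNReal.ofReal (((1 - ‖u‖) ^ 2)⁻¹)) *
            ((C * NNReal.pi) * (diskWeight α u * ENNReal.ofReal (‖f u‖ ^ p))) := by ring
        _ = _ := by rw [hone, one_mul]
    refine (setLIntegral_mono' measurableSet_unitDisk hle).trans_lt ?_
    have hCt : C * NNReal.pi ≠ ∞ := ENNReal.mul_ne_top hC (by simp)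
    rw [lintegral_const_mul' _ _ hCt]
    exact ENNReal.mul_lt_top hCt.lt_top hint
  · exact ((measurable_one.indicator hS).aemeasurable).mul hQ.comp_snd

/-! ### Change of variables under the radial pull. -/

/-- The radial self-map of the punctured disk (near the boundary) that multiplies the distance
`1 - |z|` to the unit circle by `K`. -/
noncomputable def radialPull (K : ℝ) (z : ℂ) : ℂ := ((1 - K * (1 - ‖z‖) : ℝ) : ℂ) * (z / ‖z‖)

theorem measurable_radialPull (K : ℝ) : Measurable (radialPull K) := by
  unfold radialPull
  fun_prop

/-- Under s = 1 - K(1 - r), dr contributes K⁻¹ and the weight K^(-α), up to 4^|α|. Starting at r = 1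
- 1/(2K) forces s > 1/2, so that r ≤ 2s. -/
theorem lintegral_radial_weight_comp_le (α : ℝ) {K : ℝ} (hK : 2 ≤ K) (H : ℝ → ℝ≥0∞) :
    ∫⁻ r in Set.Ioo (1 - 1 / (2 * K)) 1,
        ENNReal.ofReal (r * (1 - r ^ 2) ^ α) * H (1 - K * (1 - r)) ≤
      ENNReal.ofReal (2 * 4 ^ |α| * K ^ (-(1 + α))) *
        ∫⁻ s in Set.Ioo 0 1, ENNReal.ofReal (s * (1 - s ^ 2) ^ α) * H s := by
  have hK0 : 0 < K := by linarith
  set a := 1 - 1 / (2 * K) with ha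
  have haK : K * (1 - a) = 1 / 2 := by rw [ha]; field_simp; ring
  have himg : (fun r : ℝ => 1 - K * (1 - r)) '' Set.Ioo a 1 ⊆ Set.Ioo 0 1 := by
    rintro _ ⟨r, ⟨h1, h2⟩, rfl⟩
    constructor <;> simp only <;> nlinarith
  refine le_trans ?_ (mul_le_mul_right (lintegral_mono_set himg) _)
  have hder : ∀ r ∈ Set.Ioo a 1,
      HasDerivWithinAt (fun r : ℝ => 1 - K * (1 - r)) K (Set.Ioo a 1) r := fun r _ => by
    have := (((hasDerivAt_id r).const_sub 1).const_mul K).const_sub 1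
    simpa using this.hasDerivWithinAt
  rw [lintegral_image_eq_lintegral_abs_deriv_mul measurableSet_Ioo hder
    (fun x _ y _ h => mul_left_cancel₀ hK0.ne' (by linarith [show 1 - K * (1 - x) = 1 - K * (1 - y) from h])), ← lintegral_const_mul' _ _ ENNReal.ofReal_ne_top]
  refine setLIntegral_mono' measurableSet_Ioo fun r hr => ?_
  rw [← mul_assoc, ← mul_assoc]
  refine mul_le_mul_left ?_ _
  obtain ⟨h1, h2⟩ := hr
  set s := 1 - K * (1 - r) with hs
  have hs1 : 1 / 2 < s := by nlinarith
  have hs2 : s < 1 := by nlinarith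
  have hr0 : 0 < r := by nlinarith
  have hrs : 1 - r = (1 - s) / K := by rw [hs]; field_simp; ring
  have hr2 : 0 < 1 - r ^ 2 := by nlinarith
  have hs22 : 0 < 1 - s ^ 2 := by nlinarith
  have hb : (1 - s ^ 2) / K = (1 - r) * (1 + s) := by rw [hrs]; ring
  have hw : (1 - r ^ 2) ^ α ≤ 4 ^ |α| * ((1 - s ^ 2) / K) ^ α := by
    apply rpow_le_four_rpow_abs_mul hr2 (by positivity) <;> rw [hb] <;> nlinarith
  rw [abs_of_pos hK0, ← ENNReal.ofReal_mul (by positivity), ← ENNReal.ofReal_mul (by positivity)]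
  apply ENNReal.ofReal_le_ofReal
  have hKα : K ^ (-(1 + α)) * K = (K ^ α)⁻¹ := by
    rw [← Real.rpow_neg hK0.le, ← Real.rpow_add_one hK0.ne']
    congr 1; ring
  calc r * (1 - r ^ 2) ^ α ≤ (2 * s) * (4 ^ |α| * ((1 - s ^ 2) / K) ^ α) := by
        gcongr; linarith
    _ = 2 * 4 ^ |α| * (K ^ α)⁻¹ * (s * (1 - s ^ 2) ^ α) := by
        rw [Real.div_rpow hs22.le hK0.le]; ring
    _ = _ := by rw [← hKα]; ring

theorem norm_polarCoord_symm {q : ℝ × ℝ} (hq : 0 < q.1) : ‖Complex.polarCoord.symm q‖ = q.1 := by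
  rw [Complex.norm_polarCoord_symm, abs_of_pos hq]

theorem radialPull_polarCoord_symm (K : ℝ) {q : ℝ × ℝ} (hq : 0 < q.1) :
    radialPull K (Complex.polarCoord.symm q) =
      Complex.polarCoord.symm (1 - K * (1 - q.1), q.2) := by
  have h : (q.1 : ℂ) ≠ 0 := by exact_mod_cast hq.ne'
  rw [radialPull, norm_polarCoord_symm hq, Complex.polarCoord_symm_apply,
    Complex.polarCoord_symm_apply, mul_div_cancel_left₀ _ h]

theorem measurableSet_annulus (a : ℝ) : MeasurableSet {z : ℂ | a < ‖z‖ ∧ ‖z‖ < 1} :=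
  measurableSet_Ioo.preimage measurable_norm

theorem setLIntegral_polar {a : ℝ} (ha : 0 ≤ a) (α : ℝ) {F : ℂ → ℝ≥0∞} (hF : Measurable F) :
    ∫⁻ z in {z : ℂ | a < ‖z‖ ∧ ‖z‖ < 1}, diskWeight α z * F z =
      ∫⁻ θ in Set.Ioo (-Real.pi) Real.pi, ∫⁻ r in Set.Ioo a 1,
        ENNReal.ofReal (r * (1 - r ^ 2) ^ α) * F (Complex.polarCoord.symm (r, θ)) := by
  have hS : MeasurableSet {z : ℂ | a < ‖z‖ ∧ ‖z‖ < 1} :=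
    measurableSet_annulus a
  have hsymm : Measurable (fun q : ℝ × ℝ => Complex.polarCoord.symm q) := by
    simp only [Complex.polarCoord_symm_apply]
    fun_prop
  have hm : Measurable fun q : ℝ × ℝ => (Set.Ioo a 1 : Set ℝ).indicator 1 q.1 *
      (ENNReal.ofReal (q.1 * (1 - q.1 ^ 2) ^ α) * F (Complex.polarCoord.symm q)) := by
    have h1 : Measurable fun q : ℝ × ℝ => (Set.Ioo a 1 : Set ℝ).indicator (1 : ℝ → ℝ≥0∞) q.1 :=
      (measurable_one.indicator measurableSet_Ioo).comp measurable_fst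
    have h2 := hF.comp hsymm
    have h3 : Measurable fun q : ℝ × ℝ => ENNReal.ofReal (q.1 * (1 - q.1 ^ 2) ^ α) := by fun_prop
    exact h1.mul (h3.mul h2)
  have hT : MeasurableSet Complex.polarCoord.target := by
    rw [Complex.polarCoord_target]; measurability
  rw [← lintegral_indicator hS, ← Complex.lintegral_comp_polarCoord_symm]
  have hcongr : ∀ q ∈ Complex.polarCoord.target, ENNReal.ofReal q.1 •
      ({z : ℂ | a < ‖z‖ ∧ ‖z‖ < 1}.indicator (fun z => diskWeight α z * F z))
        (Complex.polarCoord.symm q) = (Set.Ioo a 1 : Set ℝ).indicator 1 q.1 *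
      (ENNReal.ofReal (q.1 * (1 - q.1 ^ 2) ^ α) * F (Complex.polarCoord.symm q)) := by
    intro q hq
    rw [Complex.polarCoord_target] at hq
    have hq1 : 0 < q.1 := hq.1
    by_cases h : a < q.1 ∧ q.1 < 1
    · rw [Set.indicator_of_mem (by rwa [Set.mem_ofPred_eq, norm_polarCoord_symm hq1]),
        Set.indicator_of_mem (by exact h), Pi.one_apply, one_mul, ENNReal.ofReal_mul hq1.le,
        diskWeight, norm_polarCoord_symm hq1, smul_eq_mul, mul_assoc]
    · rw [Set.indicator_of_notMem (by rwa [Set.mem_ofPred_eq, norm_polarCoord_symm hq1]),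
        Set.indicator_of_notMem (by exact h), smul_zero, zero_mul]
  have hT' : Complex.polarCoord.target = polarCoord.target := by
    rw [Complex.polarCoord_target, polarCoord_target]
  rw [← hT', setLIntegral_congr_fun hT hcongr, Complex.polarCoord_target, Measure.volume_eq_prod,
    ← Measure.prod_restrict, lintegral_prod_symm _ hm.aemeasurable]
  refine lintegral_congr fun θ => ?_
  have hpt : ∀ r : ℝ, (Set.Ioo a 1 : Set ℝ).indicator 1 r *
      (ENNReal.ofReal (r * (1 - r ^ 2) ^ α) * F (Complex.polarCoord.symm (r, θ))) =
      (Set.Ioo a 1 : Set ℝ).indicator (fun r => ENNReal.ofReal (r * (1 - r ^ 2) ^ α) *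
        F (Complex.polarCoord.symm (r, θ))) r := by
    intro r
    by_cases h : r ∈ Set.Ioo a 1 <;> simp [h]
  simp only [hpt]
  rw [lintegral_indicator measurableSet_Ioo, Measure.restrict_restrict measurableSet_Ioo,
    Set.inter_eq_left.2 (show Set.Ioo a 1 ⊆ Set.Ioi 0 from fun r hr => ha.trans_lt hr.1)]

theorem lintegral_comp_radialPull_le (α : ℝ) {K : ℝ} (hK : 2 ≤ K) {F : ℂ → ℝ≥0∞}
    (hF : Measurable F) :
    ∫⁻ z in {z : ℂ | 1 - 1 / (2 * K) < ‖z‖ ∧ ‖z‖ < 1}, diskWeight α z * F (radialPull K z) ≤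
      ENNReal.ofReal (2 * 4 ^ |α| * K ^ (-(1 + α))) *
        ∫⁻ z in unitDisk, diskWeight α z * F z := by
  have ha : 0 ≤ 1 - 1 / (2 * K) := by
    rw [sub_nonneg, div_le_one (by linarith)]; linarith
  refine (setLIntegral_polar ha α (hF.comp (measurable_radialPull K))).trans_le ?_
  have hsub : {z : ℂ | 0 < ‖z‖ ∧ ‖z‖ < 1} ⊆ unitDisk := fun z hz => mem_unitDisk.2 hz.2
  refine le_trans ?_ (mul_le_mul_right (lintegral_mono_set hsub) _)
  rw [setLIntegral_polar le_rfl α hF, ← lintegral_const_mul' _ _ ENNReal.ofReal_ne_top]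
  refine lintegral_mono fun θ => ?_
  refine le_trans (le_of_eq ?_) (lintegral_radial_weight_comp_le α hK
    fun s => F (Complex.polarCoord.symm (s, θ)))
  refine setLIntegral_congr_fun measurableSet_Ioo fun r hr => ?_
  simp only [Function.comp_apply]
  rw [radialPull_polarCoord_symm K (q := (r, θ)) (ha.trans_lt hr.1)]

/-! ### Distances between z and its radial pull. -/

section Geometry

variable {K : ℝ} {z : ℂ}

theorem radialPull_radius_mem (hK : 2 ≤ K) (h1 : 1 - 1 / (2 * K) < ‖z‖) (h2 : ‖z‖ < 1) :
    1 / 2 < 1 - K * (1 - ‖z‖) ∧ 1 - K * (1 - ‖z‖) ≤ ‖z‖ := by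
  have h : K * (1 / (2 * K)) = 1 / 2 := by field_simp
  constructor <;> nlinarith

theorem norm_radialPull (hK : 2 ≤ K) (h1 : 1 - 1 / (2 * K) < ‖z‖) (h2 : ‖z‖ < 1) :
    ‖radialPull K z‖ = 1 - K * (1 - ‖z‖) := by
  obtain ⟨h3, h4⟩ := radialPull_radius_mem hK h1 h2
  have hz : ‖z‖ ≠ 0 := by linarith
  rw [radialPull, norm_mul, norm_div, Complex.norm_real, Complex.norm_real, norm_norm,
    div_self hz, mul_one, Real.norm_of_nonneg (by linarith)]

theorem norm_sub_radialPull (hK : 2 ≤ K) (h1 : 1 - 1 / (2 * K) < ‖z‖) (h2 : ‖z‖ < 1) :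
    ‖z - radialPull K z‖ = ‖z‖ - (1 - K * (1 - ‖z‖)) := by
  obtain ⟨h3, h4⟩ := radialPull_radius_mem hK h1 h2
  have hz : ‖z‖ ≠ 0 := by linarith
  have hz' : (‖z‖ : ℂ) ≠ 0 := by exact_mod_cast hz
  have h : z - radialPull K z = ((‖z‖ - (1 - K * (1 - ‖z‖)) : ℝ) : ℂ) * (z / ‖z‖) := by
    rw [radialPull]; push_cast; field_simp
  rw [h, norm_mul, norm_div, Complex.norm_real, Complex.norm_real, norm_norm,
    div_self hz, mul_one, Real.norm_of_nonneg (by linarith)]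

theorem norm_one_sub_conj_mul_radialPull (hK : 2 ≤ K) (h1 : 1 - 1 / (2 * K) < ‖z‖)
    (h2 : ‖z‖ < 1) :
    ‖1 - (starRingEnd ℂ) z * radialPull K z‖ = 1 - ‖z‖ * (1 - K * (1 - ‖z‖)) := by
  obtain ⟨h3, h4⟩ := radialPull_radius_mem hK h1 h2
  have hz : ‖z‖ ≠ 0 := by linarith
  have hz' : (‖z‖ : ℂ) ≠ 0 := by exact_mod_cast hz
  have h : 1 - (starRingEnd ℂ) z * radialPull K z
      = ((1 - ‖z‖ * (1 - K * (1 - ‖z‖)) : ℝ) : ℂ) := by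
    have hc := Complex.conj_mul' z
    rw [radialPull]; push_cast; field_simp
    linear_combination (-(1 - (K : ℂ) * (1 - ‖z‖))) * hc
  rw [h, Complex.norm_real, Real.norm_of_nonneg (by nlinarith)]

/-- With r = |z| and s = 1 - K(1 - r), (1 + ρ)/(1 - ρ) = (1 + r)(1 - s)/((1 - r)(1 + s)) = K(1 +
r)/(1 + s) ≤ 2K. -/
theorem hyperbolicDist_radialPull_le (hK : 2 ≤ K) (h1 : 1 - 1 / (2 * K) < ‖z‖)
    (h2 : ‖z‖ < 1) : hyperbolicDist z (radialPull K z) ≤ 1 / 2 * Real.log (2 * K) := by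
  obtain ⟨h3, h4⟩ := radialPull_radius_mem hK h1 h2
  rw [hyperbolicDist, pseudoHyperbolicDist, norm_div, norm_sub_radialPull hK h1 h2,
    norm_one_sub_conj_mul_radialPull hK h1 h2]
  set r := ‖z‖
  have hr : K * (1 - r) = 1 - (1 - K * (1 - r)) := by ring
  set s := 1 - K * (1 - r)
  have hden : 0 < 1 - r * s := by nlinarith
  have hq : (1 + (r - s) / (1 - r * s)) / (1 - (r - s) / (1 - r * s))
      = ((1 + r) * (1 - s)) / ((1 - r) * (1 + s)) := by
    have h5 : (1 - r) * (1 + s) ≠ 0 := by apply ne_of_gt; apply mul_pos <;> linarith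
    have h6 : 1 - (r - s) / (1 - r * s) = (1 - r) * (1 + s) / (1 - r * s) := by
      field_simp; ring
    have h7 : 1 + (r - s) / (1 - r * s) = (1 + r) * (1 - s) / (1 - r * s) := by
      field_simp; ring
    rw [h6, h7, div_div_div_cancel_right₀ hden.ne']
  have hpos : 0 < (1 - r) * (1 + s) := by apply mul_pos <;> linarith
  have hpos' : 0 < (1 + r) * (1 - s) := by apply mul_pos <;> nlinarith
  rw [hq]
  gcongr
  rw [div_le_iff₀ hpos, ← hr]
  have : 0 < K * (1 - r) := by nlinarith
  nlinarith

end Geometry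

/-! ### The absorption argument. -/

/-- Since A does not depend on K, K can be fixed with contraction factor at most 1/2 before B is
known. The integral I over |z| < R is finite and the pull keeps this disk inside itself, so I ≤ Y +
I/2 with Y independent of R. Then R tends to 1. -/
theorem lintegral_lt_top_of_le_comp_radialPull {α : ℝ} (hα : -1 < α) {F G : ℂ → ℝ≥0∞}
    (hF : Measurable F) (hG : Measurable G) {A : ℝ} (hA : 0 ≤ A)
    (h : ∀ K : ℝ, 2 ≤ K → ∃ B : ℝ≥0∞, B ≠ ∞ ∧ ∀ z : ℂ, 1 - 1 / (2 * K) < ‖z‖ → ‖z‖ < 1 →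
      F z ≤ ENNReal.ofReal A * F (radialPull K z) + B * (G z + G (radialPull K z)))
    (hloc : ∀ R < 1, ∫⁻ z in ball 0 R, diskWeight α z * F z < ∞)
    (hGint : ∫⁻ z in unitDisk, diskWeight α z * G z < ∞) :
    ∫⁻ z in unitDisk, diskWeight α z * F z < ∞ := by
  obtain ⟨K, hK, hKA⟩ : ∃ K : ℝ, 2 ≤ K ∧ A * (2 * 4 ^ |α| * K ^ (-(1 + α))) ≤ 1 / 2 := by
    have ht : Filter.Tendsto (fun K : ℝ => A * (2 * 4 ^ |α| * K ^ (-(1 + α)))) Filter.atTop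
        (nhds (A * (2 * 4 ^ |α| * 0))) :=
      ((tendsto_rpow_neg_atTop (by linarith)).const_mul _).const_mul _
    have h1 := ht.eventually (Iic_mem_nhds (by norm_num : A * (2 * 4 ^ |α| * 0) < 1 / 2))
    obtain ⟨K, hK1, hK2⟩ := (h1.and (Filter.eventually_ge_atTop 2)).exists
    exact ⟨K, hK2, hK1⟩
  obtain ⟨B, hB, hle⟩ := h K hK
  set c := 2 * 4 ^ |α| * K ^ (-(1 + α)) with hc
  set a := 1 - 1 / (2 * K) with ha
  have ha1 : a < 1 := by
    have : 0 < 1 / (2 * K) := by positivity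
    linarith
  set S := {z : ℂ | a < ‖z‖ ∧ ‖z‖ < 1} with hSdef
  have hS : MeasurableSet S :=
    measurableSet_annulus a
  have hSD : S ⊆ unitDisk := fun z hz => mem_unitDisk.2 hz.2
  have hw := measurable_diskWeight α
  have hφ := measurable_radialPull K
  set IG := ∫⁻ z in unitDisk, diskWeight α z * G z
  -- The radius (a + 1)/2 exceeds a, so this ball and S together cover the circle |z| = a as well.
  set X := ∫⁻ z in ball 0 ((a + 1) / 2), diskWeight α z * F z with hX
  set Y := X + B * (IG + ENNReal.ofReal c * IG) with hY
  have hYtop : Y < ∞ := by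
    refine ENNReal.add_lt_top.2 ⟨hloc _ (by linarith), ENNReal.mul_lt_top hB.lt_top ?_⟩
    exact ENNReal.add_lt_top.2 ⟨hGint, ENNReal.mul_lt_top ENNReal.ofReal_lt_top hGint⟩
  have hbound : ∀ R < 1, ∫⁻ z in ball 0 R, diskWeight α z * F z ≤ 2 * Y := by
    intro R hR
    set I := ∫⁻ z in ball 0 R, diskWeight α z * F z with hI
    have hIR : I ≠ ∞ := (hloc R hR).ne
    set FR := (ball (0 : ℂ) R).indicator F with hFR
    have hFRm : Measurable FR := hF.indicator measurableSet_ball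
    have hsplit : I ≤ X + ∫⁻ z in S, diskWeight α z * FR z := by
      have hsub : ball (0 : ℂ) R ⊆ ball 0 ((a + 1) / 2) ∪ (S ∩ ball 0 R) := by
        intro z hz
        by_cases hz' : z ∈ ball (0 : ℂ) ((a + 1) / 2)
        · exact Or.inl hz'
        · right
          refine ⟨?_, hz⟩
          rw [mem_ball, dist_zero_right] at hz hz'
          constructor <;> linarith
      refine (lintegral_mono_set hsub).trans ((lintegral_union_le _ _ _).trans ?_)
      refine add_le_add le_rfl ?_
      rw [Set.inter_comm, ← Measure.restrict_restrict measurableSet_ball,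
        ← lintegral_indicator measurableSet_ball]
      refine lintegral_mono fun z => ?_
      by_cases hz : z ∈ ball (0 : ℂ) R <;> simp [FR, Set.indicator, hz]
    have hstep : ∫⁻ z in S, diskWeight α z * FR z ≤
        ENNReal.ofReal A * (ENNReal.ofReal c * I) + B * (IG + ENNReal.ofReal c * IG) := by
      have hpt : ∀ z ∈ S, diskWeight α z * FR z ≤
          ENNReal.ofReal A * (diskWeight α z * FR (radialPull K z)) +
            B * (diskWeight α z * G z + diskWeight α z * G (radialPull K z)) := by
        rintro z ⟨hz1, hz2⟩
        by_cases hz : z ∈ ball (0 : ℂ) R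
        · have hz' : radialPull K z ∈ ball (0 : ℂ) R := by
            rw [mem_ball, dist_zero_right] at hz ⊢
            rw [norm_radialPull hK hz1 hz2]
            exact (radialPull_radius_mem hK hz1 hz2).2.trans_lt hz
          rw [hFR, Set.indicator_of_mem hz, Set.indicator_of_mem hz']
          refine (mul_le_mul_right (hle z hz1 hz2) _).trans_eq ?_
          ring
        · rw [hFR, Set.indicator_of_notMem hz, mul_zero]
          exact zero_le
      have hm1 : Measurable fun z => diskWeight α z * FR (radialPull K z) := by fun_prop
      have hm2 : Measurable fun z => diskWeight α z * G z := by fun_prop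
      refine (setLIntegral_mono' hS hpt).trans ?_
      rw [lintegral_add_left (by fun_prop), lintegral_const_mul' _ _ ENNReal.ofReal_ne_top,
        lintegral_const_mul' _ _ hB, lintegral_add_left hm2]
      gcongr
      · refine (lintegral_comp_radialPull_le α hK hFRm).trans (mul_le_mul_right ?_ _)
        rw [hI, ← lintegral_indicator measurableSet_ball]
        refine (setLIntegral_le_lintegral _ _).trans (lintegral_mono fun z => ?_)
        by_cases hz : z ∈ ball (0 : ℂ) R <;> simp [FR, Set.indicator, hz]
      · exact lintegral_mono_set hSD
      · exact lintegral_comp_radialPull_le α hK hG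
    have hhalf : ENNReal.ofReal A * (ENNReal.ofReal c * I) ≤ I / 2 := by
      rw [← mul_assoc, ← ENNReal.ofReal_mul hA, ENNReal.div_eq_inv_mul]
      gcongr
      refine (ENNReal.ofReal_le_ofReal hKA).trans_eq ?_
      rw [one_div, ENNReal.ofReal_inv_of_pos two_pos]; simp
    have hfin : I / 2 + I / 2 ≤ Y + I / 2 := by
      rw [ENNReal.add_halves, hY]
      refine hsplit.trans ((add_le_add le_rfl (hstep.trans (add_le_add hhalf le_rfl))).trans_eq ?_)
      ring
    have h2 : I / 2 ≤ Y :=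
      (ENNReal.add_le_add_iff_right (ENNReal.div_ne_top hIR two_ne_zero)).1 hfin
    calc I = 2 * (I / 2) := by rw [two_mul, ENNReal.add_halves]
      _ ≤ 2 * Y := by gcongr
  have hU : unitDisk = ⋃ n : ℕ, ball (0 : ℂ) (1 - 1 / ((n : ℝ) + 1)) := by
    ext z
    simp only [Set.mem_iUnion, mem_ball, dist_zero_right, mem_unitDisk]
    constructor
    · intro hz
      obtain ⟨n, hn⟩ := exists_nat_one_div_lt (sub_pos.2 hz)
      exact ⟨n, by linarith⟩
    · rintro ⟨n, hn⟩
      have : 0 < 1 / ((n : ℝ) + 1) := by positivity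
      linarith
  have hmono : Monotone fun n : ℕ => ball (0 : ℂ) (1 - 1 / ((n : ℝ) + 1)) := by
    intro m n hmn
    apply ball_subset_ball
    have : 1 / ((n : ℝ) + 1) ≤ 1 / ((m : ℝ) + 1) := by gcongr
    linarith
  rw [hU, setLIntegral_iUnion_of_directed _ hmono.directed_le]
  refine (iSup_le fun n => hbound _ ?_).trans_lt (ENNReal.mul_lt_top (by simp) hYtop)
  have : 0 < 1 / ((n : ℝ) + 1) := by positivity
  linarith

theorem add_add_rpow_le {p a b c : ℝ} (hp : 0 < p) (ha : 0 ≤ a) (hb : 0 ≤ b) (hc : 0 ≤ c) :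
    (a + b + c) ^ p ≤ 3 ^ p * (a ^ p + b ^ p + c ^ p) := by
  have ha' := Real.rpow_nonneg ha p
  have hb' := Real.rpow_nonneg hb p
  have hc' := Real.rpow_nonneg hc p
  obtain ⟨m, hm0, hm, hmp⟩ : ∃ m : ℝ, 0 ≤ m ∧ a + b + c ≤ 3 * m ∧ m ^ p ≤ a ^ p + b ^ p + c ^ p := by
    rcases le_total a b with h1 | h1 <;> rcases le_total b c with h2 | h2 <;>
      rcases le_total a c with h3 | h3
    · exact ⟨c, hc, by linarith, by linarith⟩
    · exact ⟨c, hc, by linarith, by linarith⟩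
    · exact ⟨b, hb, by linarith, by linarith⟩
    · exact ⟨b, hb, by linarith, by linarith⟩
    · exact ⟨c, hc, by linarith, by linarith⟩
    · exact ⟨a, ha, by linarith, by linarith⟩
    · exact ⟨a, ha, by linarith, by linarith⟩
    · exact ⟨a, ha, by linarith, by linarith⟩
  calc (a + b + c) ^ p ≤ (3 * m) ^ p := Real.rpow_le_rpow (by positivity) hm hp.le
    _ = 3 ^ p * m ^ p := Real.mul_rpow (by norm_num) hm0
    _ ≤ _ := by gcongr

/-- Raising the three-term triangle inequality to the power p costs 3^p; only the coefficient of the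
g terms involves K, as absorption requires. -/
theorem lintegral_rpow_lt_top_of_norm_sub_radialPull_le {p α : ℝ} (hp : 0 < p) (hα : -1 < α)
    {f : ℂ → ℂ} (hf : ContinuousOn f unitDisk) {g : ℂ → ℝ} (hg : ContinuousOn g unitDisk)
    (h : ∀ K : ℝ, 2 ≤ K → ∃ C : ℝ, 0 ≤ C ∧ ∀ z : ℂ, 1 - 1 / (2 * K) < ‖z‖ → ‖z‖ < 1 →
      ‖f z - f (radialPull K z)‖ ≤ C * (|g z| + |g (radialPull K z)|))
    (hgint : ∫⁻ z in unitDisk, diskWeight α z * ENNReal.ofReal (|g z| ^ p) < ∞) :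
    ∫⁻ z in unitDisk, diskWeight α z * ENNReal.ofReal (‖f z‖ ^ p) < ∞ := by
  -- Functions continuous only on the disk become Borel on ℂ once cut off there.
  have hmeas : ∀ u : ℂ → ℝ, ContinuousOn u unitDisk →
      Measurable (unitDisk.indicator fun z => ENNReal.ofReal (u z)) := fun u hu => by
    classical
    rw [← Set.piecewise_eq_indicator]
    exact (ENNReal.continuous_ofReal.comp_continuousOn hu).measurable_piecewise
      continuousOn_const measurableSet_unitDisk
  have hfp : ContinuousOn (fun z => ‖f z‖ ^ p) unitDisk :=
    hf.norm.rpow_const fun _ _ => Or.inr hp.le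
  have hgp : ContinuousOn (fun z => |g z| ^ p) unitDisk :=
    hg.abs.rpow_const fun _ _ => Or.inr hp.le
  have hind : ∀ u : ℂ → ℝ≥0∞, ∫⁻ z in unitDisk, diskWeight α z * unitDisk.indicator u z =
      ∫⁻ z in unitDisk, diskWeight α z * u z := fun u =>
    setLIntegral_congr_fun measurableSet_unitDisk fun z hz => by
      simp only [Set.indicator_of_mem hz]
  rw [← hind] at hgint ⊢
  refine lintegral_lt_top_of_le_comp_radialPull hα (hmeas _ hfp) (hmeas _ hgp)
    (A := 3 ^ p) (by positivity) ?_ ?_ hgint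
  · intro K hK
    obtain ⟨C, hC, hle⟩ := h K hK
    refine ⟨ENNReal.ofReal (3 ^ p * C ^ p), ENNReal.ofReal_ne_top, fun z h1 h2 => ?_⟩
    have hz : z ∈ unitDisk := mem_unitDisk.2 h2
    have hφ : radialPull K z ∈ unitDisk := by
      rw [mem_unitDisk, norm_radialPull hK h1 h2]
      linarith [(radialPull_radius_mem hK h1 h2).2]
    simp only [Set.indicator_of_mem hz, Set.indicator_of_mem hφ]
    rw [← ENNReal.ofReal_add (by positivity) (by positivity), ← ENNReal.ofReal_mul (by positivity),
      ← ENNReal.ofReal_mul (by positivity), ← ENNReal.ofReal_add (by positivity) (by positivity)]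
    apply ENNReal.ofReal_le_ofReal
    have hz3 : ‖f z‖ ≤ ‖f (radialPull K z)‖ + C * |g z| + C * |g (radialPull K z)| := by
      have := norm_add_le (f (radialPull K z)) (f z - f (radialPull K z))
      rw [add_sub_cancel] at this
      linarith [hle z h1 h2]
    calc ‖f z‖ ^ p ≤ (‖f (radialPull K z)‖ + C * |g z| + C * |g (radialPull K z)|) ^ p := by gcongr
      _ ≤ _ := add_add_rpow_le hp (by positivity) (by positivity) (by positivity)
      _ = _ := by
        rw [Real.mul_rpow hC (abs_nonneg _), Real.mul_rpow hC (abs_nonneg _)]; ring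
  · intro R hR
    have hsub : closedBall (0 : ℂ) R ⊆ unitDisk := closedBall_subset_ball hR
    have hcont : ContinuousOn (fun z : ℂ => (1 - ‖z‖ ^ 2) ^ α * ‖f z‖ ^ p) (closedBall 0 R) := by
      refine ContinuousOn.mul ?_ (hfp.mono hsub)
      exact ContinuousOn.rpow_const (by fun_prop) fun z hz =>
        Or.inl (one_sub_norm_sq_pos (hsub hz)).ne'
    have hint := (hcont.integrableOn_compact (μ := volume) (isCompact_closedBall _ _)).mono_set
      ball_subset_closedBall
    refine lt_of_eq_of_lt ?_ hint.setLIntegral_lt_top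
    refine setLIntegral_congr_fun measurableSet_ball fun z hz => ?_
    have hzD := hsub (ball_subset_closedBall hz)
    simp only [Set.indicator_of_mem hzD]
    rw [diskWeight, ENNReal.ofReal_mul (Real.rpow_nonneg (one_sub_norm_sq_pos hzD).le _)]

/-! ### Comparison of the metrics and the implications. -/

theorem pseudoHyperbolicDist_lt_one {z w : ℂ} (hz : z ∈ unitDisk) (hw : w ∈ unitDisk) :
    pseudoHyperbolicDist z w < 1 := by
  rw [pseudoHyperbolicDist, norm_div, div_lt_one (norm_one_sub_conj_mul_pos hz hw)]
  refine lt_of_pow_lt_pow_left₀ 2 (norm_nonneg _) ?_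
  have h : ‖1 - (starRingEnd ℂ) z * w‖ ^ 2 - ‖z - w‖ ^ 2 = (1 - ‖z‖ ^ 2) * (1 - ‖w‖ ^ 2) := by
    simp only [← Complex.normSq_eq_norm_sq, Complex.normSq_apply]
    simp
    ring
  have := mul_pos (one_sub_norm_sq_pos hz) (one_sub_norm_sq_pos hw)
  linarith

/-- ρ is the first term of the power series of β = artanh ρ, whose terms are nonnegative. -/
theorem pseudoHyperbolicDist_le_hyperbolicDist {z w : ℂ} (hz : z ∈ unitDisk)
    (hw : w ∈ unitDisk) : pseudoHyperbolicDist z w ≤ hyperbolicDist z w := by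
  have h1 := pseudoHyperbolicDist_lt_one hz hw
  have h0 : 0 ≤ pseudoHyperbolicDist z w := norm_nonneg _
  rw [hyperbolicDist]
  set ρ := pseudoHyperbolicDist z w
  have hsum := Real.hasSum_log_sub_log_of_abs_lt_one (x := ρ) (by rwa [abs_of_nonneg h0])
  have := hsum.summable.le_tsum 0 fun j _ => by positivity
  rw [hsum.tsum_eq] at this
  rw [Real.log_div (by linarith) (by linarith)]
  norm_num at this
  linarith

/-- A Lipschitz majorant may be replaced by its absolute value. -/
theorem norm_sub_le_mul_abs_add_abs {d a b x : ℝ} (hd : 0 ≤ d) (h : x ≤ d * (a + b)) :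
    x ≤ d * (|a| + |b|) :=
  h.trans (mul_le_mul_of_nonneg_left (add_le_add (le_abs_self a) (le_abs_self b)) hd)

theorem radialPull_mem_unitDisk {K : ℝ} {z : ℂ} (hK : 2 ≤ K) (h1 : 1 - 1 / (2 * K) < ‖z‖)
    (h2 : ‖z‖ < 1) : radialPull K z ∈ unitDisk := by
  rw [mem_unitDisk, norm_radialPull hK h1 h2]
  linarith [(radialPull_radius_mem hK h1 h2).2]

variable {p α : ℝ} {f : ℂ → ℂ}

theorem MemBergman.hasLipschitzMajorant (hp : 0 < p) (hα : -1 < α) (h : MemBergman p α f) :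
    HasLipschitzMajorant p (weightedArea α) pseudoHyperbolicDist f := by
  obtain ⟨hf, hint⟩ := h
  have hcont : ContinuousOn (localSup f) unitDisk := continuousOn_localSup hf.continuousOn
  refine ⟨fun z => 18 * localSup f z, continuousOn_const.mul hcont, ?_, fun z hz w hw =>
    norm_sub_le_pseudoHyperbolicDist_mul_localSup hf hz hw⟩
  have hM : MemLp (localSup f) (ENNReal.ofReal p) (weightedArea α) := by
    rw [memLp_weightedArea_iff hp hα hcont]
    refine lt_of_eq_of_lt (setLIntegral_congr_fun measurableSet_unitDisk fun z hz => ?_)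
      (lintegral_localSup_lt_top hp α hf ((lintegral_weightedArea_lt_top_iff hα _).1 hint))
    simp only [abs_of_nonneg (localSup_nonneg hf.continuousOn hz)]
  exact hM.const_mul 18

theorem HasLipschitzMajorant.hyperbolicDist_of_pseudoHyperbolicDist {μ : Measure ℂ}
    (h : HasLipschitzMajorant p μ pseudoHyperbolicDist f) :
    HasLipschitzMajorant p μ hyperbolicDist f := by
  obtain ⟨g, hg, hgp, hle⟩ := h
  -- Enlarging the metric preserves the bound only when its cofactor is nonnegative, hence |g|.
  refine ⟨fun z => |g z|, hg.abs, hgp.abs, fun z hz w hw => ?_⟩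
  refine (norm_sub_le_mul_abs_add_abs (norm_nonneg _) (hle z hz w hw)).trans ?_
  exact mul_le_mul_of_nonneg_right (pseudoHyperbolicDist_le_hyperbolicDist hz hw) (by positivity)

theorem diskWeight_mul_rpow {z : ℂ} (hz : z ∈ unitDisk) (p α x : ℝ) :
    diskWeight α z * ENNReal.ofReal (|(1 - ‖z‖ ^ 2) * x| ^ p) =
      diskWeight (p + α) z * ENNReal.ofReal (|x| ^ p) := by
  have h := one_sub_norm_sq_pos hz
  rw [diskWeight, diskWeight, ← ENNReal.ofReal_mul (by positivity),
    ← ENNReal.ofReal_mul (by positivity), abs_mul, abs_of_pos h,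
    Real.mul_rpow h.le (abs_nonneg _), Real.rpow_add h]
  congr 1
  ring

/-- This is where the exponent p + α comes from: the p-th power of 1 - |z|² joins the weight. -/
theorem memLp_one_sub_norm_sq_mul_iff (hp : 0 < p) (hα : -1 < α) {g : ℂ → ℝ}
    (hg : ContinuousOn g unitDisk) :
    MemLp (fun z => (1 - ‖z‖ ^ 2) * g z) (ENNReal.ofReal p) (weightedArea α) ↔
      MemLp g (ENNReal.ofReal p) (weightedArea (p + α)) := by
  have hc : ContinuousOn (fun z : ℂ => (1 - ‖z‖ ^ 2) * g z) unitDisk :=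
    ContinuousOn.mul (by fun_prop) hg
  rw [memLp_weightedArea_iff hp hα hc,
    memLp_weightedArea_iff hp (by linarith) hg,
    setLIntegral_congr_fun measurableSet_unitDisk fun z hz => diskWeight_mul_rpow hz p α (g z)]

/-- |1 - z̄w| dominates both 1 - |z| and 1 - |w|, so each term of the majorant can be divided by its
own factor; the 2 comes from 1 - |v|² ≤ 2(1 - |v|). -/
theorem HasLipschitzMajorant.euclidean_of_pseudoHyperbolicDist (hp : 0 < p) (hα : -1 < α)
    (h : HasLipschitzMajorant p (weightedArea α) pseudoHyperbolicDist f) :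
    HasLipschitzMajorant p (weightedArea (p + α)) (fun z w => ‖z - w‖) f := by
  obtain ⟨g, hg, hgp, hle⟩ := h
  have hcont : ContinuousOn (fun z => (1 - ‖z‖ ^ 2)⁻¹ * (2 * |g z|)) unitDisk :=
    (ContinuousOn.inv₀ (by fun_prop) fun z hz => (one_sub_norm_sq_pos hz).ne').mul
      (continuousOn_const.mul hg.abs)
  refine ⟨fun z => (1 - ‖z‖ ^ 2)⁻¹ * (2 * |g z|), hcont, ?_, fun z hz w hw => ?_⟩
  · have hc : ContinuousOn (fun z : ℂ => (1 - ‖z‖ ^ 2) * ((1 - ‖z‖ ^ 2)⁻¹ * (2 * |g z|)))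
        unitDisk := ContinuousOn.mul (by fun_prop) hcont
    rw [← memLp_one_sub_norm_sq_mul_iff hp hα hcont, memLp_weightedArea_iff hp hα hc]
    have hc2 : ContinuousOn (fun z => 2 * |g z|) unitDisk := continuousOn_const.mul hg.abs
    have h2 := (memLp_weightedArea_iff hp hα hc2).1 (hgp.abs.const_mul 2)
    refine lt_of_eq_of_lt (setLIntegral_congr_fun measurableSet_unitDisk fun z hz => ?_) h2
    simp only [mul_inv_cancel_left₀ (one_sub_norm_sq_pos hz).ne']
  · refine (norm_sub_le_mul_abs_add_abs (norm_nonneg _) (hle z hz w hw)).trans ?_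
    have hD := norm_one_sub_conj_mul_pos hz hw
    have hz' := mem_unitDisk.1 hz
    have hw' := mem_unitDisk.1 hw
    have hzD := one_sub_norm_le_norm_one_sub_conj_mul (z := z) hw
    have hwD : 1 - ‖w‖ ≤ ‖1 - (starRingEnd ℂ) z * w‖ := by
      have := one_sub_norm_le_norm_one_sub_conj_mul (z := w) hz
      rwa [← RCLike.norm_conj (1 - _), map_sub, map_one, map_mul, starRingEnd_self_apply,
        mul_comm] at this
    have hbound : ∀ v ∈ unitDisk, 1 - ‖v‖ ≤ ‖1 - (starRingEnd ℂ) z * w‖ →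
        |g v| / ‖1 - (starRingEnd ℂ) z * w‖ ≤ (1 - ‖v‖ ^ 2)⁻¹ * (2 * |g v|) := by
      intro v hv hvD
      have hv1 := one_sub_norm_sq_pos hv
      have hv' := mem_unitDisk.1 hv
      rw [inv_mul_eq_div, div_le_div_iff₀ hD hv1]
      have : 1 - ‖v‖ ^ 2 ≤ 2 * ‖1 - (starRingEnd ℂ) z * w‖ := by nlinarith [norm_nonneg v]
      nlinarith [abs_nonneg (g v)]
    rw [norm_div, div_mul_eq_mul_div, mul_div_assoc, add_div]
    exact mul_le_mul_of_nonneg_left (add_le_add (hbound z hz hzD) (hbound w hw hwD))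
      (norm_nonneg _)

theorem memBergman_of_norm_sub_radialPull_le (hp : 0 < p) (hα : -1 < α)
    (hf : AnalyticOnNhd ℂ f unitDisk) {g : ℂ → ℝ} (hg : ContinuousOn g unitDisk)
    (hgp : MemLp g (ENNReal.ofReal p) (weightedArea α))
    (h : ∀ K : ℝ, 2 ≤ K → ∃ C : ℝ, 0 ≤ C ∧ ∀ z : ℂ, 1 - 1 / (2 * K) < ‖z‖ → ‖z‖ < 1 →
      ‖f z - f (radialPull K z)‖ ≤ C * (|g z| + |g (radialPull K z)|)) :
    MemBergman p α f := by
  refine ⟨hf, (lintegral_weightedArea_lt_top_iff hα _).2 ?_⟩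
  exact lintegral_rpow_lt_top_of_norm_sub_radialPull_le hp hα hf.continuousOn hg h
    ((memLp_weightedArea_iff hp hα hg).1 hgp)

theorem HasLipschitzMajorant.memBergman_of_hyperbolicDist (hp : 0 < p) (hα : -1 < α)
    (hf : AnalyticOnNhd ℂ f unitDisk)
    (h : HasLipschitzMajorant p (weightedArea α) hyperbolicDist f) : MemBergman p α f := by
  obtain ⟨g, hg, hgp, hle⟩ := h
  refine memBergman_of_norm_sub_radialPull_le hp hα hf hg hgp fun K hK =>
    ⟨1 / 2 * Real.log (2 * K), mul_nonneg (by norm_num) (Real.log_nonneg (by linarith)),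
      fun z h1 h2 => ?_⟩
  have hz : z ∈ unitDisk := mem_unitDisk.2 h2
  have hφ := radialPull_mem_unitDisk hK h1 h2
  have h0 : 0 ≤ hyperbolicDist z (radialPull K z) :=
    (norm_nonneg _).trans (pseudoHyperbolicDist_le_hyperbolicDist hz hφ)
  refine (norm_sub_le_mul_abs_add_abs h0 (hle z hz _ hφ)).trans ?_
  exact mul_le_mul_of_nonneg_right (hyperbolicDist_radialPull_le hK h1 h2) (by positivity)

/-- The Euclidean displacement is at most K(1 - |z|), and 1 - |z| is at most both 1 - |z|² and 1 -
|φ(z)|², so (1 - |z|²)g serves as majorant along the pull. -/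
theorem HasLipschitzMajorant.memBergman_of_euclidean (hp : 0 < p) (hα : -1 < α)
    (hf : AnalyticOnNhd ℂ f unitDisk)
    (h : HasLipschitzMajorant p (weightedArea (p + α)) (fun z w => ‖z - w‖) f) :
    MemBergman p α f := by
  obtain ⟨g, hg, hgp, hle⟩ := h
  refine memBergman_of_norm_sub_radialPull_le hp hα hf
    (g := fun z => (1 - ‖z‖ ^ 2) * g z) (ContinuousOn.mul (by fun_prop) hg)
    ((memLp_one_sub_norm_sq_mul_iff hp hα hg).2 hgp) fun K hK =>
    ⟨K, by linarith, fun z h1 h2 => ?_⟩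
  have hz : z ∈ unitDisk := mem_unitDisk.2 h2
  have hφ := radialPull_mem_unitDisk hK h1 h2
  refine (norm_sub_le_mul_abs_add_abs (norm_nonneg _) (hle z hz _ hφ)).trans ?_
  rw [norm_sub_radialPull hK h1 h2, abs_mul, abs_mul, abs_of_pos (one_sub_norm_sq_pos hz),
    abs_of_pos (one_sub_norm_sq_pos hφ), norm_radialPull hK h1 h2]
  obtain ⟨h3, h4⟩ := radialPull_radius_mem hK h1 h2
  have hd : ‖z‖ - (1 - K * (1 - ‖z‖)) ≤ K * (1 - ‖z‖) := by linarith
  have hzle : 1 - ‖z‖ ≤ 1 - ‖z‖ ^ 2 := by nlinarith [norm_nonneg z]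
  have hφle : 1 - ‖z‖ ≤ 1 - (1 - K * (1 - ‖z‖)) ^ 2 := by nlinarith
  calc (‖z‖ - (1 - K * (1 - ‖z‖))) * (|g z| + |g (radialPull K z)|)
      ≤ (K * (1 - ‖z‖)) * (|g z| + |g (radialPull K z)|) := by gcongr
    _ = K * ((1 - ‖z‖) * |g z| + (1 - ‖z‖) * |g (radialPull K z)|) := by ring
    _ ≤ _ := by gcongr

theorem theorem1 (p α : ℝ) (hp : 0 < p) (hα : -1 < α) (f : ℂ → ℂ)
    (hf : AnalyticOnNhd ℂ f unitDisk) :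
    List.TFAE [
      MemBergman p α f,
      HasLipschitzMajorant p (weightedArea α) pseudoHyperbolicDist f,
      HasLipschitzMajorant p (weightedArea α) hyperbolicDist f,
      HasLipschitzMajorant p (weightedArea (p + α)) (fun z w => ‖z - w‖) f] := by
  tfae_have 1 → 2 := fun h => h.hasLipschitzMajorant hp hα
  tfae_have 2 → 3 := fun h => h.hyperbolicDist_of_pseudoHyperbolicDist
  tfae_have 3 → 1 := fun h => h.memBergman_of_hyperbolicDist hp hα hf
  tfae_have 2 → 4 := fun h => h.euclidean_of_pseudoHyperbolicDist hp hα
  tfae_have 4 → 1 := fun h => h.memBergman_of_euclidean hp hα hf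
  tfae_finish
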